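/- Let $m,\sigma\ge 1$ be integers. Consider an urn that initially contains $W_0\ge 0$ white and $B_0\ge 0$ black balls, $T_0=W_0+B_0\ge m$. At each step $m$ balls are drawn, either without replacement (model $\mathcal M$) or with replacement (model $\mathcal R$), and returned to the urn; if the sample contains $k$ white and $m-k$ black balls, then $a_{m-k}$ white and $b_{m-k}$ black balls are added, where the $a_j,b_j$ are integers. Thus, given the past, if the urn contains $w$ white and $b$ black balls, the probability of drawing exactly $k$ white balls is $\binom wk\binom b{m-k}/\binom{w+b}m$ in model $\mathcal M$ and $\binom mk w^k b^{m-k}/(w+b)^m$ in model $\mathcal R$. The urn is assumed to be balanced ($a_k+b_k=\sigma$ for $0\le k\le m$), affine ($a_k=(m-k)(a_{m-1}-a_m)+a_m$ for $0\le k\le m$) and tenable (no composition with a negative number of white or black balls is ever reached with positive probability). Let $W_n$ be the number of white balls after $n$ draws, $T_n=T_0+\sigma n$, and put $$\Lambda=\frac m\sigma(a_{m-1}-a_m),\qquad g_n=\prod_{j=0}^{n-1}\frac{T_j}{T_j+m(a_{m-1}-a_m)},\qquad \tilde W_n=W_n-\frac{a_m}{1-\Lambda}\,n,$$ where $\frac{a_m}{1-\Lambda}$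 is read as $0$ if $a_m=0$. (1) Large-index urns. Let $\frac12<\Lambda<1$. Then $\mathcal W_n=g_n(W_n-\mathbb E[W_n])$ converges almost surely to a limit $\mathcal W_\infty$; the limits $E_s=\lim_{n\to\infty}\mathbb E\big[\tilde W_n^s/n^{s\Lambda}\big]$ exist for all integers $s\ge 0$; and for every integer $s\ge 1$ the moment $\mathbb E[\mathcal W_\infty^s]$ exists (that is, $\mathbb E|\mathcal W_\infty|^s<\infty$) and $$\mathbb E[\mathcal W_\infty^s]=\sum_{k=0}^{s}\binom sk\left(\frac{\Gamma(\frac{T_0}\sigma+\Lambda)}{\Gamma(\frac{T_0}\sigma)}\right)^{k}E_k\left(\frac{a_mT_0}{\sigma(1-\Lambda)}-W_0\right)^{s-k}.$$ (2) Triangular urns. Let $a_m=0$ and $a_{m-1}>0$. Then $\mathfrak W_n=g_nW_n$ converges almost surely to a limit $\mathfrak W_\infty$; the limits $E_s=\lim_{n\to\infty}\mathbb E\big[\tilde W_n^s/n^{s\Lambda}\big]$ exist for all integers $s\ge 0$ (here $\tilde W_n=W_n$); and for every integer $s\ge 1$ the moment $\mathbb E[\mathfrak W_\infty^s]$ exists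 and $$\mathbb E[\mathfrak W_\infty^s]=\left(\frac{\Gamma(\frac{T_0}\sigma+\Lambda)}{\Gamma(\frac{T_0}\sigma)}\right)^{s}E_s.$$ -/

import Mathlib

open Filter Topology MeasureTheory

/-- The two sampling models: the `m` balls of one draw are taken from the urn without
replacement (model `ℳ`) or with replacement (model `ℛ`). -/
inductive SamplingModel where
  | withoutReplacement
  | withReplacement

/-- The probability that a sample of size `m` from an urn with `w` white and `b` black balls
contains exactly `k` white balls: hypergeometric or binomial, according to the model. -/
noncomputable def drawProb (M : SamplingModel) (m w b k : ℕ) : ℝ :=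
  match M with
  | .withoutReplacement =>
      ((w.choose k : ℝ) * (b.choose (m - k) : ℝ)) / ((w + b).choose m : ℝ)
  | .withReplacement =>
      (m.choose k : ℝ) * ((w : ℝ) ^ k * (b : ℝ) ^ (m - k)) / ((w : ℝ) + (b : ℝ)) ^ m

/-- A balanced affine two-color urn scheme with sample size `m`. If a sample with `k` white and
`m - k` black balls is drawn, then `a (m - k)` white and `b (m - k)` black balls are added
(removed, if negative). Only the rows `0, …, m` of the replacement matrix matter. -/
structure AffineUrn where
  /-- sample size -/
  m : ℕ
  /-- total balance -/
  σ : ℕ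
  /-- first column of the replacement matrix -/
  a : ℕ → ℤ
  /-- second column of the replacement matrix -/
  b : ℕ → ℤ
  /-- initial number of white balls -/
  W₀ : ℕ
  /-- initial number of black balls -/
  B₀ : ℕ
  one_le_m : 1 ≤ m
  one_le_σ : 1 ≤ σ
  balanced : ∀ k ≤ m, a k + b k = σ
  affine : ∀ k ≤ m, a k = ((m : ℤ) - k) * (a (m - 1) - a m) + a m
  m_le_total : m ≤ W₀ + B₀

namespace AffineUrn

/-- The compositions (white, black) which the urn can attain with positive probability. -/
inductive Reachable (U : AffineUrn) (M : SamplingModel) : ℤ → ℤ → Prop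
  | start : Reachable U M U.W₀ U.B₀
  | step {w b : ℤ} (k : ℕ) (hk : k ≤ U.m) (h : Reachable U M w b)
      (hp : 0 < drawProb M U.m w.toNat b.toNat k) :
      Reachable U M (w + U.a (U.m - k)) (b + U.b (U.m - k))

/-- The urn is tenable: drawing and replacing can be continued forever, that is, no color ever
gets a negative number of balls. -/
def Tenable (U : AffineUrn) (M : SamplingModel) : Prop :=
  ∀ w b : ℤ, U.Reachable M w b → 0 ≤ w ∧ 0 ≤ b

/-- The number `T_n = T_0 + σ n` of balls after `n` draws. -/
def total (U : AffineUrn) (n : ℕ) : ℕ := U.W₀ + U.B₀ + U.σ * n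

/-- The urn index `Λ = (m / σ) (a_{m-1} - a_m)`. -/
noncomputable def index (U : AffineUrn) : ℝ :=
  (U.m : ℝ) / (U.σ : ℝ) * ((U.a (U.m - 1) : ℝ) - (U.a U.m : ℝ))

/-- `g_n = ∏_{j < n} T_j / (T_j + m (a_{m-1} - a_m))`. -/
noncomputable def g (U : AffineUrn) (n : ℕ) : ℝ :=
  ∏ j ∈ Finset.range n,
    (U.total j : ℝ) /
      ((U.total j : ℝ) + (U.m : ℝ) * ((U.a (U.m - 1) : ℝ) - (U.a U.m : ℝ)))

/-- The ratio `Γ(T_0/σ + Λ) / Γ(T_0/σ)`. -/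
noncomputable def gammaRatio (U : AffineUrn) : ℝ :=
  Real.Gamma ((U.total 0 : ℝ) / (U.σ : ℝ) + U.index) / Real.Gamma ((U.total 0 : ℝ) / (U.σ : ℝ))

section

variable {Ω : Type*}

/-- The number `W_n` of white balls after `n` draws, where `X i` is the number of white balls in
draw number `i + 1`. -/
def white (U : AffineUrn) (X : ℕ → Ω → Fin (U.m + 1)) (n : ℕ) (ω : Ω) : ℤ :=
  U.W₀ + ∑ i ∈ Finset.range n, U.a (U.m - (X i ω : ℕ))

/-- The number `B_n` of black balls after `n` draws. -/
def black (U : AffineUrn) (X : ℕ → Ω → Fin (U.m + 1)) (n : ℕ) (ω : Ω) : ℤ :=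
  U.B₀ + ∑ i ∈ Finset.range n, U.b (U.m - (X i ω : ℕ))

/-- The sigma-algebra `ℱ_n` generated by the first `n` draws. -/
abbrev drawSigma (U : AffineUrn) (X : ℕ → Ω → Fin (U.m + 1)) (n : ℕ) : MeasurableSpace Ω :=
  ⨆ i ∈ Finset.range n, MeasurableSpace.comap (X i) ⊤

/-- `X 0, X 1, …` are the numbers of white balls in the successive samples drawn from the urn:
given the first `n` draws, the next sample has the hypergeometric or binomial law that belongs
to the current composition of the urn. -/
structure IsDrawSequence (U : AffineUrn) (M : SamplingModel) [MeasurableSpace Ω]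
    (μ : Measure Ω) (X : ℕ → Ω → Fin (U.m + 1)) : Prop where
  measurable : ∀ n, Measurable (X n)
  condProb : ∀ (n : ℕ) (k : Fin (U.m + 1)),
    μ[({ω | X n ω = k}).indicator (fun _ => (1 : ℝ)) | U.drawSigma X n] =ᵐ[μ]
      fun ω => drawProb M U.m (U.white X n ω).toNat (U.black X n ω).toNat k

/-- `𝒲_n = g_n (W_n - 𝔼 W_n)`. -/
noncomputable def centered (U : AffineUrn) [MeasurableSpace Ω] (μ : Measure Ω)
    (X : ℕ → Ω → Fin (U.m + 1)) (n : ℕ) (ω : Ω) : ℝ :=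
  U.g n * ((U.white X n ω : ℝ) - ∫ ω', (U.white X n ω' : ℝ) ∂μ)

/-- `𝔚_n = g_n W_n`. -/
noncomputable def scaled (U : AffineUrn) (X : ℕ → Ω → Fin (U.m + 1)) (n : ℕ) (ω : Ω) : ℝ :=
  U.g n * (U.white X n ω : ℝ)

/-- The pointwise limit `𝒲_∞` of `𝒲_n` (an arbitrary value where there is no limit). -/
noncomputable def centeredLimit (U : AffineUrn) [MeasurableSpace Ω] (μ : Measure Ω)
    (X : ℕ → Ω → Fin (U.m + 1)) (ω : Ω) : ℝ :=
  limUnder atTop (fun n => U.centered μ X n ω)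

/-- The pointwise limit `𝔚_∞` of `𝔚_n` (an arbitrary value where there is no limit). -/
noncomputable def scaledLimit (U : AffineUrn) (X : ℕ → Ω → Fin (U.m + 1)) (ω : Ω) : ℝ :=
  limUnder atTop (fun n => U.scaled X n ω)

/-- The shifted variable `W̃_n = W_n - (a_m / (1 - Λ)) n`. For `a_m = 0` the quotient is `0`,
also when `Λ = 1`. -/
noncomputable def shifted (U : AffineUrn) (X : ℕ → Ω → Fin (U.m + 1)) (n : ℕ) (ω : Ω) : ℝ :=
  (U.white X n ω : ℝ) - (U.a U.m : ℝ) / (1 - U.index) * (n : ℝ)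

/-- `E s` is the limit of `𝔼[W̃_n ^ s / n ^ (s Λ)]`, for every `s`. -/
def IsShiftedMomentLimit (U : AffineUrn) [MeasurableSpace Ω] (μ : Measure Ω)
    (X : ℕ → Ω → Fin (U.m + 1)) (E : ℕ → ℝ) : Prop :=
  ∀ s : ℕ, Tendsto
    (fun n : ℕ => ∫ ω, U.shifted X n ω ^ s / (n : ℝ) ^ ((s : ℝ) * U.index) ∂μ) atTop (𝓝 (E s))

end

end AffineUrn

/-! Both sampling laws have mean `m w / (w + b)`, so for an affine urn the conditional drift of
`W_n` is an affine function of `W_n`. Hence, if `c (σ - m * slope) = a_m`, the process `M_n = g_n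
(W_n - c T_n)` is a martingale (`martingale_martValue`). Its increments are uniformly bounded.

Everything rests on one variance estimate: the conditional variance of the increment is at most `ε_n
(1 + |M_n|)` with `∑ ε_n` finite. Then `𝔼 (1 + M_n ^ 2) ^ s` grows by a factor at most `1 + K ε_n`
per step, so all moments stay bounded (`exists_moment_bound`), and `M_n` converges almost surely and
in all moments to some `Y` (`exists_limit`). For `Λ > 1/2` one takes `ε_n` of order `g_{n+1} ^ 2`,
summable since `g_n ~ const * n ^ (-Λ)`. For triangular urns the variance carries an extra factor
`W_n / T_n`, which yields the telescoping choice `ε_n = const * (g_n - g_{n+1})` and makes every `Λ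
> 0` admissible.

The formulas are then algebra. The normalised and the centered processes differ from `M_n` by a
constant, `g_n W̃_n` differs from it by `g_n c T_0 → 0`, and `g_n n ^ Λ` tends to the Gamma ratio.
So `E_s = 𝔼 Y ^ s / gammaRatio ^ s`, and the binomial theorem absorbs the constant. -/

/-! ### Moments of the hypergeometric and binomial laws. -/

lemma drawProb_nonneg (M : SamplingModel) (m w b k : ℕ) : 0 ≤ drawProb M m w b k := by
  cases M <;> simp only [drawProb] <;> positivity

lemma sum_choose_mul_choose (w b m : ℕ) :
    ∑ k ∈ Finset.range (m + 1), w.choose k * b.choose (m - k) = (w + b).choose m := by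
  rw [Nat.add_choose_eq, Finset.Nat.sum_antidiagonal_eq_sum_range_succ_mk]

/-- Absorption, `k * C(w, k) = w * C(w - 1, k - 1)`, followed by Vandermonde. This is the
hypergeometric mean with denominators cleared, so that it can be proved in `ℕ`. -/
lemma sum_choose_mul_choose_mul (w b m : ℕ) :
    ∑ k ∈ Finset.range (m + 1), w.choose k * b.choose (m - k) * k * (w + b) =
      m * w * (w + b).choose m := by
  rcases m with _ | m
  · simp
  rcases w with _ | w
  · rw [mul_zero, zero_mul]
    refine Finset.sum_eq_zero fun k _ => ?_
    rcases k with _ | k <;> simp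
  rw [Finset.sum_range_succ', ← Finset.sum_mul]
  have h : ∑ k ∈ Finset.range (m + 1),
      (w + 1).choose (k + 1) * b.choose (m + 1 - (k + 1)) * (k + 1) =
      (w + 1) * (w + b).choose m := by
    rw [← sum_choose_mul_choose, Finset.mul_sum]
    refine Finset.sum_congr rfl fun k _ => ?_
    rw [Nat.add_sub_add_right, ← mul_assoc, Nat.add_one_mul_choose_eq]
    ring
  have h2 := Nat.add_one_mul_choose_eq (w + b) m
  rw [h, show w + 1 + b = w + b + 1 by ring]
  simp only [mul_zero, zero_mul, add_zero]
  linear_combination (w + 1) * h2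

lemma sum_choose_mul_pow_mul (x y : ℝ) (m : ℕ) :
    (∑ k ∈ Finset.range (m + 1), (m.choose k : ℝ) * (x ^ k * y ^ (m - k)) * k) * (x + y) =
      m * x * (x + y) ^ m := by
  rcases m with _ | m
  · simp
  rw [Finset.sum_range_succ']
  have h : ∑ k ∈ Finset.range (m + 1),
      ((m + 1).choose (k + 1) : ℝ) * (x ^ (k + 1) * y ^ (m + 1 - (k + 1))) * ((k + 1 : ℕ) : ℝ) =
      (m + 1) * x * (x + y) ^ m := by
    rw [add_pow, Finset.mul_sum]
    refine Finset.sum_congr rfl fun k _ => ?_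
    have h2 : ((m : ℝ) + 1) * (m.choose k : ℝ) = ((m + 1).choose (k + 1) : ℝ) * (k + 1) := by
      exact_mod_cast Nat.add_one_mul_choose_eq m k
    rw [Nat.add_sub_add_right]
    push_cast
    linear_combination (-(x ^ (k + 1) * y ^ (m - k))) * h2
  rw [h]
  push_cast
  ring

lemma sum_drawProb (M : SamplingModel) {m w b : ℕ} (hm : 1 ≤ m) (h : m ≤ w + b) :
    ∑ k : Fin (m + 1), drawProb M m w b k = 1 := by
  rw [Fin.sum_univ_eq_sum_range (fun k => drawProb M m w b k)]
  cases M <;> simp only [drawProb]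
  · rw [← Finset.sum_div, div_eq_one_iff_eq (by exact_mod_cast (Nat.choose_pos h).ne')]
    exact_mod_cast sum_choose_mul_choose w b m
  · have : (w : ℝ) + b ≠ 0 := by exact_mod_cast (by omega : w + b ≠ 0)
    rw [← Finset.sum_div, div_eq_one_iff_eq (pow_ne_zero _ this), add_pow]
    exact Finset.sum_congr rfl fun k _ => by ring

lemma sum_drawProb_mul (M : SamplingModel) {m w b : ℕ} (hm : 1 ≤ m) (h : m ≤ w + b) :
    ∑ k : Fin (m + 1), drawProb M m w b k * ((k : ℕ) : ℝ) = m * w / (w + b) := by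
  rw [Fin.sum_univ_eq_sum_range (fun k => drawProb M m w b k * (k : ℝ))]
  have hT : (w : ℝ) + b ≠ 0 := by exact_mod_cast (by omega : w + b ≠ 0)
  rw [eq_div_iff hT]
  cases M <;> simp only [drawProb, div_mul_eq_mul_div]
  · rw [← Finset.sum_div, div_mul_eq_mul_div,
      div_eq_iff (by exact_mod_cast (Nat.choose_pos h).ne'), Finset.sum_mul]
    exact_mod_cast sum_choose_mul_choose_mul w b m
  · rw [← Finset.sum_div, div_mul_eq_mul_div, div_eq_iff (pow_ne_zero _ hT)]
    exact sum_choose_mul_pow_mul _ _ _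

/-- Since `k ≤ m`, `k ^ 2 ≤ m * k`. The bound is linear in `w`, which is what the triangular case
needs. -/
lemma sum_drawProb_mul_sq_le (M : SamplingModel) {m w b : ℕ} (hm : 1 ≤ m) (h : m ≤ w + b) :
    ∑ k : Fin (m + 1), drawProb M m w b k * ((k : ℕ) : ℝ) ^ 2 ≤ m * (m * w / (w + b)) := by
  rw [← sum_drawProb_mul M hm h, Finset.mul_sum]
  refine Finset.sum_le_sum fun k _ => ?_
  have hk : ((k : ℕ) : ℝ) ≤ m := by exact_mod_cast Nat.lt_succ_iff.mp k.2
  have := mul_le_mul_of_nonneg_left hk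
    (mul_nonneg (drawProb_nonneg M m w b k) (Nat.cast_nonneg (α := ℝ) (k : ℕ)))
  linarith

/-! ### One-step growth of moments. -/

/-- A bound of Bernoulli type for powers, from above. -/
lemma exists_one_add_pow_le (s : ℕ) (C : ℝ) (hC : 0 ≤ C) :
    ∃ K : ℝ, 0 ≤ K ∧ ∀ y : ℝ, -1 ≤ y → y ≤ C → (1 + y) ^ s ≤ 1 + s * y + K * y ^ 2 := by
  induction s with
  | zero => exact ⟨0, le_rfl, fun y _ _ => by simp⟩
  | succ s ih =>
    obtain ⟨K, hK, h⟩ := ih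
    -- Multiplying the induction hypothesis by `1 + y` leaves `(s + K + K y) y ^ 2` beyond the
    -- linear part, and `y ≤ C`.
    refine ⟨s + K + K * C, by positivity, fun y h1 h2 => ?_⟩
    have h3 := mul_le_mul_of_nonneg_right (h y h1 h2) (by linarith : 0 ≤ 1 + y)
    have h4 := mul_le_mul_of_nonneg_left h2 (mul_nonneg hK (sq_nonneg y))
    rw [pow_succ]
    push_cast
    nlinarith

/-- A second-order expansion of `(1 + x ^ 2) ^ s` with bounded steps. -/
lemma exists_one_add_sq_pow_le (s : ℕ) (C : ℝ) :
    ∃ K : ℝ, 0 ≤ K ∧ ∀ x d : ℝ, |d| ≤ C →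
      (1 + (x + d) ^ 2) ^ s ≤
        (1 + x ^ 2) ^ s * (1 + 2 * s * x / (1 + x ^ 2) * d + K / (1 + x ^ 2) * d ^ 2) := by
  obtain ⟨K, hK, h⟩ := exists_one_add_pow_le s (1 + 2 * C ^ 2) (by positivity)
  refine ⟨s + K * (8 + 2 * C ^ 2), by positivity, fun x d hd => ?_⟩
  have hA : 0 < 1 + x ^ 2 := by positivity
  have hd2 : d ^ 2 ≤ C ^ 2 := sq_le_sq' (by linarith [neg_abs_le d]) (by linarith [le_abs_self d])
  -- `y` is the relative increment of `1 + x ^ 2`. It is at least `-1` because `1 + (x + d) ^ 2 ≥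
  -- 0`, and at most `1 + 2 C ^ 2` because `2 x d ≤ x ^ 2 + d ^ 2`.
  set y := (2 * x * d + d ^ 2) / (1 + x ^ 2) with hy
  have e1 : 1 + (x + d) ^ 2 = (1 + x ^ 2) * (1 + y) := by rw [hy]; field_simp; ring
  have h1 : -1 ≤ y := by rw [hy, le_div_iff₀ hA]; nlinarith [sq_nonneg (x + d)]
  have h2 : y ≤ 1 + 2 * C ^ 2 := by
    rw [hy, div_le_iff₀ hA]; nlinarith [sq_nonneg (x - d), mul_nonneg (sq_nonneg C) (sq_nonneg x)]
  have h3 : y ^ 2 ≤ (8 + 2 * C ^ 2) / (1 + x ^ 2) * d ^ 2 := by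
    rw [hy, div_pow, div_le_iff₀ (by positivity)]
    have : (8 + 2 * C ^ 2) / (1 + x ^ 2) * d ^ 2 * (1 + x ^ 2) ^ 2 =
      (8 + 2 * C ^ 2) * d ^ 2 * (1 + x ^ 2) := by field_simp
    rw [this]
    nlinarith [mul_nonneg (sq_nonneg d) (sub_nonneg.2 hd2), sq_nonneg (2 * x * d - d ^ 2),
      mul_nonneg (sq_nonneg d) (mul_nonneg (sq_nonneg C) (sq_nonneg x)), sq_nonneg d]
  rw [e1, mul_pow]
  refine mul_le_mul_of_nonneg_left ((h y h1 h2).trans ?_) (by positivity)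
  have h4 := mul_le_mul_of_nonneg_left h3 hK
  have h5 : (s : ℝ) * y = 2 * s * x / (1 + x ^ 2) * d + s / (1 + x ^ 2) * d ^ 2 := by
    rw [hy]; field_simp
  have h6 : (s + K * (8 + 2 * C ^ 2)) / (1 + x ^ 2) * d ^ 2 =
      s / (1 + x ^ 2) * d ^ 2 + K * ((8 + 2 * C ^ 2) / (1 + x ^ 2) * d ^ 2) := by ring
  linarith

/-- One step of a process whose increments are centred, bounded, and have small variance. -/
lemma exists_sum_mul_one_add_sq_pow_le (s : ℕ) (C : ℝ) :
    ∃ K : ℝ, 0 ≤ K ∧ ∀ {ι : Type} [Fintype ι] (p d : ι → ℝ) (x ε : ℝ),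
      (∀ i, 0 ≤ p i) → ∑ i, p i = 1 → ∑ i, p i * d i = 0 → (∀ i, |d i| ≤ C) →
      ∑ i, p i * d i ^ 2 ≤ ε * (1 + |x|) → 0 ≤ ε →
      ∑ i, p i * (1 + (x + d i) ^ 2) ^ s ≤ (1 + K * ε) * (1 + x ^ 2) ^ s := by
  obtain ⟨K, hK, h⟩ := exists_one_add_sq_pow_le s C
  refine ⟨2 * K, by positivity, fun {ι} _ p d x ε hp hp1 hpd hd hv hε => ?_⟩
  have hA : 0 < 1 + x ^ 2 := by positivity
  calc ∑ i, p i * (1 + (x + d i) ^ 2) ^ s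
      ≤ ∑ i, p i * ((1 + x ^ 2) ^ s *
          (1 + 2 * s * x / (1 + x ^ 2) * d i + K / (1 + x ^ 2) * d i ^ 2)) :=
        Finset.sum_le_sum fun i _ => mul_le_mul_of_nonneg_left (h x _ (hd i)) (hp i)
    _ = (1 + x ^ 2) ^ s * (∑ i, p i + 2 * s * x / (1 + x ^ 2) * ∑ i, p i * d i +
          K / (1 + x ^ 2) * ∑ i, p i * d i ^ 2) := by
        simp only [Finset.mul_sum, ← Finset.sum_add_distrib]
        exact Finset.sum_congr rfl fun i _ => by ring
    _ ≤ (1 + x ^ 2) ^ s * (1 + 2 * K * ε) := by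
        rw [hp1, hpd]
        refine mul_le_mul_of_nonneg_left ?_ (by positivity)
        have h1 : K / (1 + x ^ 2) * ∑ i, p i * d i ^ 2 ≤
            K / (1 + x ^ 2) * (ε * (1 + |x|)) :=
          mul_le_mul_of_nonneg_left hv (by positivity)
        have h2 : K / (1 + x ^ 2) * (ε * (1 + |x|)) ≤ 2 * K * ε := by
          rw [div_mul_eq_mul_div, div_le_iff₀ hA]
          -- The factor `1 / (1 + x ^ 2)` of the second-order term is what allows the variance to
          -- grow linearly in `|x|`.
          have h3 : 1 + |x| ≤ 2 * (1 + x ^ 2) := by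
            nlinarith [sq_nonneg (|x| - 1), sq_abs x]
          nlinarith [mul_le_mul_of_nonneg_left h3 (mul_nonneg hK hε)]
        linarith
    _ = _ := by ring

/-- Discrete Grönwall inequality, from `1 + ε ≤ exp ε`. -/
lemma le_mul_exp_sum {u ε : ℕ → ℝ} (hε : ∀ n, 0 ≤ ε n) (hu0 : 0 ≤ u 0)
    (h : ∀ n, u (n + 1) ≤ (1 + ε n) * u n) (n : ℕ) :
    u n ≤ u 0 * Real.exp (∑ i ∈ Finset.range n, ε i) := by
  induction n with
  | zero => simp
  | succ n ih =>
    have h1 : 1 + ε n ≤ Real.exp (ε n) := by linarith [Real.add_one_le_exp (ε n)]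
    have h2 : 0 ≤ u 0 * Real.exp (∑ i ∈ Finset.range n, ε i) := by positivity
    rw [Finset.sum_range_succ, Real.exp_add]
    calc u (n + 1) ≤ (1 + ε n) * u n := h n
      _ ≤ (1 + ε n) * (u 0 * Real.exp (∑ i ∈ Finset.range n, ε i)) :=
        mul_le_mul_of_nonneg_left ih (by linarith [hε n])
      _ ≤ Real.exp (ε n) * (u 0 * Real.exp (∑ i ∈ Finset.range n, ε i)) :=
        mul_le_mul_of_nonneg_right h1 h2
      _ = _ := by ring

/-! ### Convergence of moments. -/

/-- Almost sure convergence and a bound on the second moments imply convergence of the means. -/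
lemma integrable_and_tendsto_integral_of_sq_bound {Ω : Type*} [MeasurableSpace Ω] {μ : Measure Ω}
    [IsProbabilityMeasure μ] {f : ℕ → Ω → ℝ} {f' : Ω → ℝ} {B : ℝ}
    (hf : ∀ n, MemLp (f n) 2 μ) (hB : ∀ n, ∫ ω, f n ω ^ 2 ∂μ ≤ B)
    (hlim : ∀ᵐ ω ∂μ, Tendsto (fun n => f n ω) atTop (𝓝 (f' ω))) :
    Integrable f' μ ∧ Tendsto (fun n => ∫ ω, f n ω ∂μ) atTop (𝓝 (∫ ω, f' ω ∂μ)) := by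
  have hint : ∀ n, Integrable (f n) μ := fun n => (hf n).integrable (by norm_num)
  have hB0 : 0 ≤ B := (integral_nonneg fun ω => sq_nonneg _).trans (hB 0)
  have hUI : UniformIntegrable f 1 μ := by
    refine uniformIntegrable_of le_rfl (by norm_num) (fun n => (hint n).aestronglyMeasurable)
      fun ε hε => ?_
    -- Where `|f| ≥ C` one has `|f| ≤ f ^ 2 / C`, so the tail is at most `B / C ≤ ε`; the `+ 1`
    -- keeps `C` positive when `B = 0`.
    have hC : 0 < (B + 1) / ε := by positivity
    refine ⟨⟨(B + 1) / ε, hC.le⟩, fun n => ?_⟩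
    set C := (B + 1) / ε with hCdef
    rw [eLpNorm_one_eq_lintegral_enorm]
    have hle : ∀ ω, ‖({x | (⟨C, hC.le⟩ : NNReal) ≤ ‖f n x‖₊}.indicator (f n)) ω‖ₑ ≤
        ENNReal.ofReal (f n ω ^ 2 / C) := by
      intro ω
      by_cases h : (⟨C, hC.le⟩ : NNReal) ≤ ‖f n ω‖₊
      · rw [Set.indicator_of_mem (show ω ∈ {x | (⟨C, hC.le⟩ : NNReal) ≤ ‖f n x‖₊} from h),
          ← ofReal_norm]
        refine ENNReal.ofReal_le_ofReal ?_
        have h' : C ≤ |f n ω| := h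
        rw [Real.norm_eq_abs, le_div_iff₀ hC, ← sq_abs]
        nlinarith [abs_nonneg (f n ω)]
      · rw [Set.indicator_of_notMem (show ω ∉ {x | (⟨C, hC.le⟩ : NNReal) ≤ ‖f n x‖₊} from h)]
        simp
    refine (lintegral_mono hle).trans ?_
    rw [← ofReal_integral_eq_lintegral_ofReal ((hf n).integrable_sq.div_const C)
      (ae_of_all _ fun ω => by positivity)]
    refine ENNReal.ofReal_le_ofReal ?_
    rw [integral_div, div_le_iff₀ hC, hCdef, mul_div_cancel₀ _ hε.ne']
    linarith [hB n]
  have hmem : MemLp f' 1 μ := hUI.memLp_of_ae_tendsto hlim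
  refine ⟨memLp_one_iff_integrable.1 hmem, ?_⟩
  exact tendsto_integral_of_L1' f' hmem.aestronglyMeasurable (Eventually.of_forall hint)
    (tendsto_Lp_finite_of_tendsto_ae le_rfl (by norm_num)
      (fun n => (hint n).aestronglyMeasurable) hmem hUI.unifIntegrable hlim)

/-- Convergence of the moments of a perturbed sequence, from bounds on the moments. -/
lemma integrable_pow_and_tendsto_integral_pow {Ω : Type*} [MeasurableSpace Ω] {μ : Measure Ω}
    [IsProbabilityMeasure μ] {f : ℕ → Ω → ℝ} {f' : Ω → ℝ} {B : ℕ → ℝ}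
    (hf : ∀ n s, Integrable (fun ω => f n ω ^ s) μ)
    (hB : ∀ s n, ∫ ω, f n ω ^ (2 * s) ∂μ ≤ B s)
    (hlim : ∀ᵐ ω ∂μ, Tendsto (fun n => f n ω) atTop (𝓝 (f' ω))) (s : ℕ) :
    Integrable (fun ω => f' ω ^ s) μ ∧
      Tendsto (fun n => ∫ ω, f n ω ^ s ∂μ) atTop (𝓝 (∫ ω, f' ω ^ s ∂μ)) := by
  have e : ∀ n ω, (f n ω ^ s) ^ 2 = f n ω ^ (2 * s) := fun n ω => by ring
  refine integrable_and_tendsto_integral_of_sq_bound (B := B s) (f := fun n ω => f n ω ^ s)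
    (fun n => ?_) (fun n => ?_) ?_
  · rw [memLp_two_iff_integrable_sq (hf n s).aestronglyMeasurable]
    simp only [e]
    exact hf n _
  · simp only [e]
    exact hB s n
  · filter_upwards [hlim] with ω hω using hω.pow s

lemma integral_add_const_pow {Ω : Type*} [MeasurableSpace Ω] {μ : Measure Ω}
    {f : Ω → ℝ} (hf : ∀ s, Integrable (fun ω => f ω ^ s) μ) (c : ℝ) (s : ℕ) :
    ∫ ω, (f ω + c) ^ s ∂μ =
      ∑ k ∈ Finset.range (s + 1), (∫ ω, f ω ^ k ∂μ) * c ^ (s - k) * (s.choose k : ℝ) := by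
  simp only [add_pow]
  rw [integral_finsetSum _ fun k _ => ((hf k).mul_const _).mul_const _]
  simp only [integral_mul_const]

lemma integrable_add_const_pow {Ω : Type*} [MeasurableSpace Ω] {μ : Measure Ω}
    {f : Ω → ℝ} (hf : ∀ s, Integrable (fun ω => f ω ^ s) μ) (c : ℝ) (s : ℕ) :
    Integrable (fun ω => (f ω + c) ^ s) μ := by
  simp only [add_pow]
  exact integrable_finsetSum _ fun k _ => ((hf k).mul_const _).mul_const _

lemma tendsto_integral_add_pow {Ω : Type*} [MeasurableSpace Ω] {μ : Measure Ω}
    {f : ℕ → Ω → ℝ} {f' : Ω → ℝ} {e : ℕ → ℝ}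
    (hf : ∀ n s, Integrable (fun ω => f n ω ^ s) μ) (hf' : ∀ s, Integrable (fun ω => f' ω ^ s) μ)
    (hlim : ∀ s, Tendsto (fun n => ∫ ω, f n ω ^ s ∂μ) atTop (𝓝 (∫ ω, f' ω ^ s ∂μ)))
    (he : Tendsto e atTop (𝓝 0)) (s : ℕ) :
    Tendsto (fun n => ∫ ω, (f n ω + e n) ^ s ∂μ) atTop (𝓝 (∫ ω, f' ω ^ s ∂μ)) := by
  -- With `+ 0` inserted, both sides expand binomially and the limit can be taken term by term, `e n
  -- ^ (s - k)` tending to `0 ^ (s - k)`.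
  have h : ∫ ω, f' ω ^ s ∂μ = ∫ ω, (f' ω + 0) ^ s ∂μ := by simp
  rw [h, integral_add_const_pow hf']
  simp only [fun n => integral_add_const_pow (hf n) (e n) s]
  exact tendsto_finsetSum _ fun k _ => ((hlim k).mul (he.pow _)).mul_const _

/-! ### The urn process and its conditional law. -/

namespace AffineUrn

variable {Ω : Type*} {U : AffineUrn} {M : SamplingModel} {X : ℕ → Ω → Fin (U.m + 1)}

lemma white_zero (ω : Ω) : U.white X 0 ω = U.W₀ := by simp [white]

lemma black_zero (ω : Ω) : U.black X 0 ω = U.B₀ := by simp [black]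

lemma white_succ (n : ℕ) (ω : Ω) :
    U.white X (n + 1) ω = U.white X n ω + U.a (U.m - (X n ω : ℕ)) := by
  simp only [white, Finset.sum_range_succ, add_assoc]

lemma black_succ (n : ℕ) (ω : Ω) :
    U.black X (n + 1) ω = U.black X n ω + U.b (U.m - (X n ω : ℕ)) := by
  simp only [black, Finset.sum_range_succ, add_assoc]

lemma total_succ (n : ℕ) : U.total (n + 1) = U.total n + U.σ := by
  simp only [total]; ring

lemma white_add_black (n : ℕ) (ω : Ω) : U.white X n ω + U.black X n ω = U.total n := by
  induction n with
  | zero => simp [white, black, total]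
  | succ n ih =>
    have := U.balanced (U.m - (X n ω : ℕ)) (Nat.sub_le _ _)
    rw [white_succ, black_succ, total_succ]
    push_cast
    linarith

lemma black_eq (n : ℕ) (ω : Ω) : U.black X n ω = U.total n - U.white X n ω :=
  eq_sub_of_add_eq' (white_add_black n ω)

lemma m_le_total' (U : AffineUrn) (n : ℕ) : U.m ≤ U.total n :=
  U.m_le_total.trans (Nat.le_add_right _ _)

lemma total_pos (U : AffineUrn) (n : ℕ) : 0 < U.total n := U.one_le_m.trans (U.m_le_total' n)

/-- The change `a_{m-1} - a_m` of the number of added white balls per white ball in the sample. -/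
def slope (U : AffineUrn) : ℝ := (U.a (U.m - 1) : ℝ) - (U.a U.m : ℝ)

lemma added_eq (U : AffineUrn) (k : Fin (U.m + 1)) :
    (U.a (U.m - (k : ℕ)) : ℝ) = U.slope * (k : ℕ) + U.a U.m := by
  have hk : (k : ℕ) ≤ U.m := Nat.lt_succ_iff.mp k.2
  rw [U.affine _ (Nat.sub_le _ _), Nat.cast_sub hk, slope]
  push_cast
  ring

lemma exists_abs_white_le (X : ℕ → Ω → Fin (U.m + 1)) (n : ℕ) :
    ∃ N : ℕ, ∀ ω, |U.white X n ω| ≤ N := by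
  induction n with
  | zero => exact ⟨U.W₀, fun ω => by simp [white]⟩
  | succ n ih =>
    obtain ⟨N, hN⟩ := ih
    refine ⟨N + ∑ j ∈ Finset.range (U.m + 1), (U.a j).natAbs, fun ω => ?_⟩
    rw [white_succ]
    have h : |U.a (U.m - (X n ω : ℕ))| ≤
        ((∑ j ∈ Finset.range (U.m + 1), (U.a j).natAbs : ℕ) : ℤ) := by
      rw [Int.abs_eq_natAbs]
      exact_mod_cast Finset.single_le_sum (f := fun j => (U.a j).natAbs)
        (fun _ _ => Nat.zero_le _) (Finset.mem_range.2 (Nat.lt_succ_of_le (Nat.sub_le _ _)))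
    push_cast at h ⊢
    exact (abs_add_le _ _).trans (add_le_add (hN ω) h)

/-- For fixed `n` only finitely many values of `W_n` are possible, so integrability never needs a
growth condition on `φ`. -/
lemma exists_bound_comp_white (X : ℕ → Ω → Fin (U.m + 1)) (n : ℕ) (φ : ℤ → ℝ) :
    ∃ C : ℝ, ∀ ω, ‖φ (U.white X n ω)‖ ≤ C := by
  obtain ⟨N, hN⟩ := exists_abs_white_le X n
  exact ⟨∑ z ∈ Finset.Icc (-(N : ℤ)) N, ‖φ z‖, fun ω =>
    Finset.single_le_sum (f := fun z => ‖φ z‖) (fun _ _ => norm_nonneg _)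
      (Finset.mem_Icc.2 (abs_le.1 (hN ω)))⟩

lemma measurable_draw {i n : ℕ} (h : i < n) : Measurable[U.drawSigma X n] (X i) :=
  (comap_measurable (X i)).mono
    (le_iSup₂ (f := fun i (_ : i ∈ Finset.range n) => MeasurableSpace.comap (X i) ⊤) i
      (Finset.mem_range.2 h)) le_rfl

lemma measurable_white (n : ℕ) : Measurable[U.drawSigma X n] (U.white X n) := by
  let _ : MeasurableSpace Ω := U.drawSigma X n
  refine measurable_const.add (Finset.measurable_sum _ fun i hi => ?_)
  exact (Measurable.of_discrete (f := fun k : Fin (U.m + 1) => U.a (U.m - (k : ℕ)))).comp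
    (measurable_draw (Finset.mem_range.1 hi))

lemma stronglyMeasurable_comp_white (n : ℕ) (φ : ℤ → ℝ) :
    StronglyMeasurable[U.drawSigma X n] fun ω => φ (U.white X n ω) :=
  ((Measurable.of_discrete (f := φ)).comp (measurable_white n)).stronglyMeasurable

/-- The conditional probability of `k` white balls in the next sample, as a function of the
time and of the number of white balls. -/
noncomputable def nextProb (U : AffineUrn) (M : SamplingModel) (n : ℕ) (w : ℤ) (k : ℕ) : ℝ :=
  drawProb M U.m w.toNat (U.total n - w).toNat k

lemma nextProb_nonneg (U : AffineUrn) (M : SamplingModel) (n : ℕ) (w : ℤ) (k : ℕ) :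
    0 ≤ U.nextProb M n w k := drawProb_nonneg _ _ _ _ _

section

variable {n : ℕ} {w : ℤ} (hw : 0 ≤ w) (hw' : w ≤ U.total n)
include hw hw'

lemma toNat_add_toNat : w.toNat + (U.total n - w).toNat = U.total n := by omega

lemma sum_nextProb : ∑ k : Fin (U.m + 1), U.nextProb M n w k = 1 :=
  sum_drawProb M U.one_le_m (by rw [toNat_add_toNat hw hw']; exact U.m_le_total' n)

lemma sum_nextProb_mul :
    ∑ k : Fin (U.m + 1), U.nextProb M n w k * ((k : ℕ) : ℝ) = U.m * w / U.total n := by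
  have h := sum_drawProb_mul M (w := w.toNat) (b := (U.total n - w).toNat) U.one_le_m
    (by rw [toNat_add_toNat hw hw']; exact U.m_le_total' n)
  rw [← Nat.cast_add, toNat_add_toNat hw hw',
    show ((w.toNat : ℕ) : ℝ) = w by exact_mod_cast Int.toNat_of_nonneg hw] at h
  exact h

lemma sum_nextProb_mul_sq_le :
    ∑ k : Fin (U.m + 1), U.nextProb M n w k * ((k : ℕ) : ℝ) ^ 2 ≤
      U.m * (U.m * w / U.total n) := by
  have h := sum_drawProb_mul_sq_le M (w := w.toNat) (b := (U.total n - w).toNat) U.one_le_m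
    (by rw [toNat_add_toNat hw hw']; exact U.m_le_total' n)
  rw [← Nat.cast_add, toNat_add_toNat hw hw',
    show ((w.toNat : ℕ) : ℝ) = w by exact_mod_cast Int.toNat_of_nonneg hw] at h
  exact h

end

namespace IsDrawSequence

variable [mΩ : MeasurableSpace Ω] {μ : Measure Ω} [IsProbabilityMeasure μ]
  (hX : U.IsDrawSequence M μ X)
include hX

omit [IsProbabilityMeasure μ] in
lemma drawSigma_le (n : ℕ) : U.drawSigma X n ≤ mΩ :=
  iSup₂_le fun i _ => (hX.measurable i).comap_le

lemma integrable_comp_white (n : ℕ) (φ : ℤ → ℝ) :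
    Integrable (fun ω => φ (U.white X n ω)) μ := by
  obtain ⟨C, hC⟩ := exists_bound_comp_white X n φ
  exact Integrable.of_bound
    ((stronglyMeasurable_comp_white n φ).mono (hX.drawSigma_le n)).aestronglyMeasurable C
    (ae_of_all _ hC)

/-- Split according to the value of the next draw and pull the `ℱ_n`-measurable factor `φ (W_n) k`
out of the conditional expectation. -/
lemma condExp_comp (n : ℕ) (φ : ℤ → Fin (U.m + 1) → ℝ) :
    μ[fun ω => φ (U.white X n ω) (X n ω) | U.drawSigma X n] =ᵐ[μ]
      fun ω => ∑ k, φ (U.white X n ω) k * U.nextProb M n (U.white X n ω) k := by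
  have hmeas : ∀ k : Fin (U.m + 1), MeasurableSet {ω | X n ω = k} := fun k =>
    hX.measurable n (MeasurableSet.of_discrete (s := {k}))
  have hind : ∀ k : Fin (U.m + 1),
      Integrable (({ω | X n ω = k}).indicator (fun _ => (1 : ℝ))) μ := fun k =>
    (integrable_const _).indicator (hmeas k)
  have hprod : ∀ k : Fin (U.m + 1), Integrable ((fun ω => φ (U.white X n ω) k) *
      ({ω | X n ω = k}).indicator (fun _ => (1 : ℝ))) μ := by
    intro k
    obtain ⟨C, hC⟩ := exists_bound_comp_white X n (fun z => φ z k)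
    exact (hind k).bdd_mul
      ((stronglyMeasurable_comp_white n (fun z => φ z k)).mono
        (hX.drawSigma_le n)).aestronglyMeasurable (ae_of_all _ hC)
  have e : (fun ω => φ (U.white X n ω) (X n ω)) =
      ∑ k, (fun ω => φ (U.white X n ω) k) * ({ω | X n ω = k}).indicator (fun _ => (1 : ℝ)) := by
    funext ω
    simp [Finset.sum_apply, Set.indicator_apply]
  rw [e]
  refine (condExp_finsetSum (fun k _ => hprod k) _).trans ?_
  have h : ∀ᵐ ω ∂μ, ∀ k : Fin (U.m + 1),
      (μ[(fun ω => φ (U.white X n ω) k) * ({ω | X n ω = k}).indicator (fun _ => (1 : ℝ)) |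
        U.drawSigma X n]) ω = φ (U.white X n ω) k * U.nextProb M n (U.white X n ω) k := by
    rw [ae_all_iff]
    intro k
    filter_upwards [condExp_mul_of_stronglyMeasurable_left
      (stronglyMeasurable_comp_white n (fun z => φ z k)) (hprod k) (hind k),
      hX.condProb n k] with ω h1 h2
    rw [h1, Pi.mul_apply, h2, nextProb, black_eq]
  filter_upwards [h] with ω hω
  rw [Finset.sum_apply]
  exact Finset.sum_congr rfl fun k _ => hω k

lemma integral_comp (n : ℕ) (φ : ℤ → Fin (U.m + 1) → ℝ) :
    ∫ ω, φ (U.white X n ω) (X n ω) ∂μ =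
      ∫ ω, ∑ k, φ (U.white X n ω) k * U.nextProb M n (U.white X n ω) k ∂μ := by
  rw [← integral_condExp (hX.drawSigma_le n)]
  exact integral_congr_ae (hX.condExp_comp n φ)

lemma integrable_comp (n : ℕ) (φ : ℤ → Fin (U.m + 1) → ℝ) :
    Integrable (fun ω => φ (U.white X n ω) (X n ω)) μ := by
  obtain ⟨C, hC⟩ := exists_bound_comp_white X n (fun z => ∑ k, ‖φ z k‖)
  have hw : Measurable (U.white X n) := (measurable_white n).mono (hX.drawSigma_le n) le_rfl
  have hp : Measurable fun ω => (U.white X n ω, X n ω) := hw.prodMk (hX.measurable n)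
  have hm : Measurable fun ω => φ (U.white X n ω) (X n ω) :=
    Measurable.comp (g := fun p : ℤ × Fin (U.m + 1) => φ p.1 p.2) Measurable.of_discrete hp
  refine Integrable.of_bound hm.aestronglyMeasurable C (ae_of_all _ fun ω => ?_)
  refine le_trans ?_ ((le_abs_self _).trans (hC ω))
  exact Finset.single_le_sum (f := fun k => ‖φ (U.white X n ω) k‖) (fun _ _ => norm_nonneg _)
    (Finset.mem_univ _)

/-- The indicator of "the draw just made had conditional probability zero" integrates to zero. This
links the paths to `Reachable`, the only compositions that tenability controls. -/
lemma ae_nextProb_pos (n : ℕ) : ∀ᵐ ω ∂μ, 0 < U.nextProb M n (U.white X n ω) (X n ω) := by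
  classical
  let φ : ℤ → Fin (U.m + 1) → ℝ := fun w k => if U.nextProb M n w k = 0 then 1 else 0
  have h0 : ∫ ω, φ (U.white X n ω) (X n ω) ∂μ = 0 := by
    rw [hX.integral_comp n φ]
    refine integral_eq_zero_of_ae (ae_of_all _ fun ω => Finset.sum_eq_zero fun k _ => ?_)
    by_cases h : U.nextProb M n (U.white X n ω) k = 0 <;> simp [φ, h]
  have hint := hX.integrable_comp n φ
  rw [integral_eq_zero_iff_of_nonneg (fun ω => by dsimp only [φ]; split_ifs <;> simp) hint] at h0
  filter_upwards [h0] with ω hω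
  refine lt_of_le_of_ne (nextProb_nonneg _ _ _ _ _) fun h => ?_
  simp [φ, ← h] at hω

lemma ae_reachable : ∀ᵐ ω ∂μ, ∀ n, U.Reachable M (U.white X n ω) (U.black X n ω) := by
  filter_upwards [ae_all_iff.2 hX.ae_nextProb_pos] with ω hω n
  induction n with
  | zero =>
    rw [white_zero, black_zero]
    exact Reachable.start
  | succ n ih =>
    rw [white_succ, black_succ]
    have hp : 0 < drawProb M U.m (U.white X n ω).toNat (U.black X n ω).toNat (X n ω : ℕ) := by
      rw [black_eq]
      exact hω n
    exact Reachable.step (X n ω : ℕ) (Nat.lt_succ_iff.mp (X n ω).2) ih hp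

/-- Ensures that the `toNat` truncations in the transition law are almost surely harmless. -/
lemma ae_white_mem (hU : U.Tenable M) :
    ∀ᵐ ω ∂μ, ∀ n, 0 ≤ U.white X n ω ∧ U.white X n ω ≤ U.total n := by
  filter_upwards [hX.ae_reachable] with ω hω n
  have h := hU _ _ (hω n)
  rw [black_eq] at h
  exact ⟨h.1, by linarith [h.2]⟩

end IsDrawSequence

end AffineUrn

/-! ### The martingale and its moments. -/

namespace AffineUrn

variable {Ω : Type*} {U : AffineUrn} {M : SamplingModel} {X : ℕ → Ω → Fin (U.m + 1)}

lemma total_real_pos (U : AffineUrn) (n : ℕ) : (0 : ℝ) < U.total n := by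
  exact_mod_cast U.total_pos n

lemma m_real_pos (U : AffineUrn) : (0 : ℝ) < U.m := by exact_mod_cast U.one_le_m

lemma σ_real_pos (U : AffineUrn) : (0 : ℝ) < U.σ := by exact_mod_cast U.one_le_σ

lemma index_eq (U : AffineUrn) : U.index = U.m * U.slope / U.σ := by
  rw [index, slope]; ring

lemma g_zero (U : AffineUrn) : U.g 0 = 1 := by simp [g]

lemma g_succ (U : AffineUrn) (n : ℕ) :
    U.g (n + 1) = U.g n * ((U.total n : ℝ) / (U.total n + U.m * U.slope)) := by
  simp only [g, Finset.prod_range_succ, slope]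

/-- The martingale `g_n (W_n - c T_n)` as a function of the time and of the number of white
balls. -/
noncomputable def martValue (U : AffineUrn) (c : ℝ) (n : ℕ) (w : ℤ) : ℝ :=
  U.g n * ((w : ℝ) - c * U.total n)

/-- The increment of the martingale `g_n (W_n - c T_n)` when the sample contains `k` white balls. -/
noncomputable def martStep (U : AffineUrn) (n : ℕ) (w : ℤ) (k : ℕ) : ℝ :=
  U.g (n + 1) * U.slope * ((k : ℝ) - U.m * w / U.total n)

section

variable (hs : 0 < U.slope)
include hs

lemma denom_pos (n : ℕ) : 0 < (U.total n : ℝ) + U.m * U.slope := by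
  have := U.total_real_pos n
  have := U.m_real_pos
  positivity

lemma g_pos (n : ℕ) : 0 < U.g n :=
  Finset.prod_pos fun j _ => div_pos (U.total_real_pos j) (denom_pos hs j)

lemma g_eq_succ (n : ℕ) : U.g n = U.g (n + 1) * (1 + U.m * U.slope / U.total n) := by
  have h1 := U.total_real_pos n
  have h2 := denom_pos hs n
  rw [g_succ]
  field_simp

lemma g_succ_le (n : ℕ) : U.g (n + 1) ≤ U.g n := by
  have h1 := U.total_real_pos n
  have h2 := g_pos hs (n + 1)
  have h3 := U.m_real_pos
  rw [g_eq_succ hs n]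
  have : 0 ≤ U.m * U.slope / U.total n := by positivity
  nlinarith

lemma g_le_one (n : ℕ) : U.g n ≤ 1 := by
  induction n with
  | zero => exact U.g_zero.le
  | succ n ih => exact (g_succ_le hs n).trans ih

/-- The condition on `c` says that `c T_n` obeys the mean recursion `x ↦ x (1 + m * slope / T_n) +
a_m` of `W_n`; the factor `g` removes the multiplier. In this undivided form the condition also
admits `c = a_m = 0` with `Λ = 1`. -/
lemma martValue_succ {c : ℝ} (hc : c * (U.σ - U.m * U.slope) = U.a U.m) (n : ℕ) (w : ℤ)
    (k : Fin (U.m + 1)) :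
    U.martValue c (n + 1) (w + U.a (U.m - (k : ℕ))) =
      U.martValue c n w + U.martStep n w k := by
  have h1 := U.total_real_pos n
  have h2 := U.added_eq k
  rw [martValue, martValue, martStep, g_eq_succ hs n, total_succ]
  push_cast
  rw [h2, ← hc]
  field_simp
  ring

variable {n : ℕ} {w : ℤ} (hw : 0 ≤ w) (hw' : w ≤ U.total n)
include hw hw'

omit hs in
lemma mean_mem_Icc : 0 ≤ U.m * (w : ℝ) / U.total n ∧ U.m * (w : ℝ) / U.total n ≤ U.m := by
  have h1 := U.total_real_pos n
  have h2 : (0 : ℝ) ≤ w := by exact_mod_cast hw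
  have h3 : (w : ℝ) ≤ U.total n := by exact_mod_cast hw'
  have h4 := U.m_real_pos
  exact ⟨by positivity, by rw [div_le_iff₀ h1]; gcongr⟩

lemma abs_martStep_le (k : Fin (U.m + 1)) : |U.martStep n w k| ≤ U.slope * U.m := by
  have hk : ((k : ℕ) : ℝ) ≤ U.m := by exact_mod_cast Nat.lt_succ_iff.mp k.2
  have hk0 : (0 : ℝ) ≤ (k : ℕ) := Nat.cast_nonneg _
  obtain ⟨h1, h2⟩ := mean_mem_Icc (n := n) hw hw'
  have h3 : |((k : ℕ) : ℝ) - U.m * w / U.total n| ≤ U.m := abs_le.2 ⟨by linarith, by linarith⟩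
  have h4 := g_pos hs (n + 1)
  rw [martStep, abs_mul, abs_of_pos (mul_pos h4 hs)]
  exact mul_le_mul (by nlinarith [g_le_one hs (n + 1)]) h3 (abs_nonneg _) hs.le

omit hs in
lemma sum_nextProb_mul_martStep :
    ∑ k : Fin (U.m + 1), U.nextProb M n w k * U.martStep n w k = 0 := by
  calc ∑ k : Fin (U.m + 1), U.nextProb M n w k * U.martStep n w k
      = U.g (n + 1) * U.slope * (∑ k : Fin (U.m + 1), U.nextProb M n w k * ((k : ℕ) : ℝ)
          - U.m * w / U.total n * ∑ k : Fin (U.m + 1), U.nextProb M n w k) := by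
        rw [Finset.mul_sum, ← Finset.sum_sub_distrib, Finset.mul_sum]
        exact Finset.sum_congr rfl fun k _ => by rw [martStep]; ring
    _ = 0 := by rw [sum_nextProb hw hw', sum_nextProb_mul hw hw']; ring

omit hs in
-- Variance is at most the second moment. The factor `w / T_n` is kept because the triangular case
-- exploits it.
lemma sum_nextProb_mul_martStep_sq_le :
    ∑ k : Fin (U.m + 1), U.nextProb M n w k * U.martStep n w k ^ 2 ≤
      (U.g (n + 1) * U.slope) ^ 2 * (U.m * (U.m * w / U.total n)) := by
  have h : ∑ k : Fin (U.m + 1), U.nextProb M n w k * U.martStep n w k ^ 2 =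
      (U.g (n + 1) * U.slope) ^ 2 *
        (∑ k : Fin (U.m + 1), U.nextProb M n w k * ((k : ℕ) : ℝ) ^ 2 -
          2 * (U.m * w / U.total n) * ∑ k : Fin (U.m + 1), U.nextProb M n w k * ((k : ℕ) : ℝ) +
          (U.m * w / U.total n) ^ 2 * ∑ k : Fin (U.m + 1), U.nextProb M n w k) := by
    rw [Finset.mul_sum, Finset.mul_sum, ← Finset.sum_sub_distrib, ← Finset.sum_add_distrib,
      Finset.mul_sum]
    exact Finset.sum_congr rfl fun k _ => by rw [martStep]; ring
  rw [h, sum_nextProb hw hw', sum_nextProb_mul hw hw']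
  refine mul_le_mul_of_nonneg_left ?_ (sq_nonneg _)
  nlinarith [sum_nextProb_mul_sq_le (M := M) hw hw', sq_nonneg (U.m * (w : ℝ) / U.total n)]

end

/-- The natural filtration of the draws. -/
def drawFiltration [mΩ : MeasurableSpace Ω] (hX : ∀ n, Measurable (X n)) : Filtration ℕ mΩ where
  seq := U.drawSigma X
  mono' _ _ h := biSup_mono fun _ hi => Finset.range_mono h hi
  le' _ := iSup₂_le fun i _ => (hX i).comap_le

namespace IsDrawSequence

variable [mΩ : MeasurableSpace Ω] {μ : Measure Ω} [IsProbabilityMeasure μ]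
  (hX : U.IsDrawSequence M μ X) (hU : U.Tenable M) (hs : 0 < U.slope)
include hX hU hs

lemma martingale_martValue {c : ℝ} (hc : c * (U.σ - U.m * U.slope) = U.a U.m) :
    Martingale (fun n ω => U.martValue c n (U.white X n ω)) (drawFiltration hX.measurable) μ := by
  refine martingale_nat (fun n => stronglyMeasurable_comp_white n (U.martValue c n))
    (fun n => hX.integrable_comp_white n (U.martValue c n)) fun n => ?_
  have h := hX.condExp_comp n fun w k => U.martValue c (n + 1) (w + U.a (U.m - (k : ℕ)))
  simp only [← white_succ] at h
  refine EventuallyEq.symm (EventuallyEq.trans h ?_)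
  filter_upwards [hX.ae_white_mem hU] with ω hω
  obtain ⟨h0, h1⟩ := hω n
  simp only [martValue_succ hs hc, add_mul, Finset.sum_add_distrib, ← Finset.mul_sum,
    sum_nextProb h0 h1, mul_comm (U.martStep _ _ _), sum_nextProb_mul_martStep h0 h1]
  ring

lemma exists_moment_bound {c : ℝ} (hc : c * (U.σ - U.m * U.slope) = U.a U.m) {ε : ℕ → ℝ} {S : ℝ}
    (hε : ∀ n, 0 ≤ ε n) (hS : ∀ n, ∑ i ∈ Finset.range n, ε i ≤ S)
    (hvar : ∀ (n : ℕ) (w : ℤ), 0 ≤ w → w ≤ U.total n →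
      ∑ k : Fin (U.m + 1), U.nextProb M n w k * U.martStep n w k ^ 2 ≤
        ε n * (1 + |U.martValue c n w|)) (s : ℕ) :
    ∃ B : ℝ, ∀ n, ∫ ω, (1 + U.martValue c n (U.white X n ω) ^ 2) ^ s ∂μ ≤ B := by
  obtain ⟨K, hK, h⟩ := exists_sum_mul_one_add_sq_pow_le s (U.slope * U.m)
  set u : ℕ → ℝ := fun n => ∫ ω, (1 + U.martValue c n (U.white X n ω) ^ 2) ^ s ∂μ with hu
  have hint : ∀ n, Integrable (fun ω => (1 + U.martValue c n (U.white X n ω) ^ 2) ^ s) μ :=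
    fun n => hX.integrable_comp_white n fun w => (1 + U.martValue c n w ^ 2) ^ s
  have hu0 : 0 ≤ u 0 := integral_nonneg fun ω => by positivity
  have hstep : ∀ n, u (n + 1) ≤ (1 + K * ε n) * u n := by
    intro n
    have e := hX.integral_comp n fun w k =>
      (1 + U.martValue c (n + 1) (w + U.a (U.m - (k : ℕ))) ^ 2) ^ s
    simp only [← white_succ] at e
    rw [hu]
    dsimp only
    rw [e, ← integral_const_mul]
    refine integral_mono_ae (hX.integrable_comp_white n fun w => ∑ k : Fin (U.m + 1),
      (1 + U.martValue c (n + 1) (w + U.a (U.m - (k : ℕ))) ^ 2) ^ s * U.nextProb M n w k)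
      ((hint n).const_mul _) ?_
    filter_upwards [hX.ae_white_mem hU] with ω hω
    obtain ⟨h0, h1⟩ := hω n
    simp only [martValue_succ hs hc, mul_comm _ (U.nextProb _ _ _ _)]
    exact h _ _ _ _ (fun k => nextProb_nonneg _ _ _ _ _) (sum_nextProb h0 h1)
      (sum_nextProb_mul_martStep h0 h1) (abs_martStep_le hs h0 h1) (hvar n _ h0 h1) (hε n)
  refine ⟨u 0 * Real.exp (K * S), fun n => (le_mul_exp_sum (fun n => mul_nonneg hK (hε n)) hu0
    hstep n).trans (mul_le_mul_of_nonneg_left (Real.exp_le_exp.2 ?_) hu0)⟩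
  rw [← Finset.mul_sum]
  exact mul_le_mul_of_nonneg_left (hS n) hK

/-- The bound for `s = 1` controls the `L¹` norms, since `|x| ≤ 1 + x ^ 2`, and gives almost sure
convergence; the bounds of order `2 s` give uniform integrability of the `s`-th powers. -/
lemma exists_limit {c : ℝ} (hc : c * (U.σ - U.m * U.slope) = U.a U.m)
    (hB : ∀ s : ℕ, ∃ B : ℝ, ∀ n, ∫ ω, (1 + U.martValue c n (U.white X n ω) ^ 2) ^ s ∂μ ≤ B) :
    ∃ Y : Ω → ℝ,
      (∀ᵐ ω ∂μ, Tendsto (fun n => U.martValue c n (U.white X n ω)) atTop (𝓝 (Y ω))) ∧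
      (∀ s : ℕ, Integrable (fun ω => Y ω ^ s) μ) ∧
      ∀ s : ℕ, Tendsto (fun n => ∫ ω, U.martValue c n (U.white X n ω) ^ s ∂μ) atTop
        (𝓝 (∫ ω, Y ω ^ s ∂μ)) := by
  choose B hB using hB
  have hmart := hX.martingale_martValue hU hs hc
  have hint : ∀ n s, Integrable (fun ω => U.martValue c n (U.white X n ω) ^ s) μ :=
    fun n s => hX.integrable_comp_white n fun w => U.martValue c n w ^ s
  have hint' : ∀ n s, Integrable (fun ω => (1 + U.martValue c n (U.white X n ω) ^ 2) ^ s) μ :=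
    fun n s => hX.integrable_comp_white n fun w => (1 + U.martValue c n w ^ 2) ^ s
  have hL1 : ∀ n, eLpNorm (fun ω => U.martValue c n (U.white X n ω)) 1 μ ≤ (B 1).toNNReal := by
    intro n
    rw [eLpNorm_one_eq_lintegral_enorm,
      ← ofReal_integral_norm_eq_lintegral_enorm (hX.integrable_comp_white n (U.martValue c n))]
    refine ENNReal.ofReal_le_ofReal (le_trans (integral_mono
      (hX.integrable_comp_white n (U.martValue c n)).norm (hint' n 1) fun ω => ?_) (hB 1 n))
    set x := U.martValue c n (U.white X n ω)
    rw [pow_one, Real.norm_eq_abs]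
    nlinarith [sq_nonneg (|x| - 1), sq_abs x]
  have hlim := hmart.submartingale.ae_tendsto_limitProcess hL1
  have hmom := integrable_pow_and_tendsto_integral_pow hint (B := B) (fun s n =>
    le_trans (integral_mono (hint n _) (hint' n s) fun ω => by
      dsimp only
      rw [pow_mul]
      exact pow_le_pow_left₀ (sq_nonneg _) (by linarith) s) (hB s n)) hlim
  exact ⟨_, hlim, fun s => (hmom s).1, fun s => (hmom s).2⟩

end IsDrawSequence

end AffineUrn

/-! ### Asymptotics of `g_n`. -/

/-- Quotient of Euler's limit formulas for `Γ (t + l)` and `Γ t`. -/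
lemma tendsto_prod_div_mul_rpow {t l : ℝ} (ht : 0 < t) (hl : 0 < l) :
    Tendsto (fun n : ℕ => (∏ j ∈ Finset.range n, (t + j) / (t + l + j)) * (n : ℝ) ^ l) atTop
      (𝓝 (Real.Gamma (t + l) / Real.Gamma t)) := by
  have h1 := ((Real.GammaSeq_tendsto_Gamma (t + l)).div (Real.GammaSeq_tendsto_Gamma t)
    (Real.Gamma_pos_of_pos ht).ne')
  -- The products in `Real.GammaSeq` include the factor `j = n`; this quotient removes it.
  have h2 : Tendsto (fun n : ℕ => (t + l + (n : ℝ)) / (t + (n : ℝ))) atTop (𝓝 1) := by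
    have h3 : Tendsto (fun n : ℕ => 1 + l / (t + (n : ℝ))) atTop (𝓝 (1 + 0)) :=
      tendsto_const_nhds.add (tendsto_const_nhds.div_atTop
        (tendsto_atTop_add_const_left _ _ tendsto_natCast_atTop_atTop))
    rw [add_zero] at h3
    refine h3.congr fun n => ?_
    have : 0 < t + (n : ℝ) := by positivity
    field_simp
    ring
  have h3 := h1.mul h2
  rw [mul_one] at h3
  refine h3.congr' ?_
  filter_upwards [eventually_gt_atTop 0] with n hn
  have hn' : (0 : ℝ) < n := by exact_mod_cast hn
  have hp1 : 0 < ∏ j ∈ Finset.range n, (t + (j : ℝ)) := Finset.prod_pos fun j _ => by positivity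
  have hp2 : 0 < ∏ j ∈ Finset.range n, (t + l + (j : ℝ)) :=
    Finset.prod_pos fun j _ => by positivity
  have h4 : 0 < t + (n : ℝ) := by positivity
  have h5 : 0 < t + l + (n : ℝ) := by positivity
  have h6 : 0 < (n : ℝ) ^ t := Real.rpow_pos_of_pos hn' _
  have h7 : (0 : ℝ) < n.factorial := by exact_mod_cast n.factorial_pos
  simp only [Pi.div_apply, Real.GammaSeq, Finset.prod_range_succ, Finset.prod_div_distrib,
    Real.rpow_add hn']
  field_simp

namespace AffineUrn

variable {U : AffineUrn} (hs : 0 < U.slope)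
include hs

lemma index_pos : 0 < U.index := by
  rw [index_eq]
  have := U.m_real_pos
  have := U.σ_real_pos
  positivity

lemma gammaRatio_pos : 0 < U.gammaRatio := by
  have h : 0 < (U.total 0 : ℝ) / U.σ := div_pos (U.total_real_pos 0) U.σ_real_pos
  exact div_pos (Real.Gamma_pos_of_pos (add_pos h (index_pos hs))) (Real.Gamma_pos_of_pos h)

lemma tendsto_g_mul_rpow :
    Tendsto (fun n : ℕ => U.g n * (n : ℝ) ^ U.index) atTop (𝓝 U.gammaRatio) := by
  refine (tendsto_prod_div_mul_rpow (div_pos (U.total_real_pos 0) U.σ_real_pos)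
    (index_pos hs)).congr fun n => ?_
  rw [g]
  congr 1
  refine Finset.prod_congr rfl fun j _ => ?_
  have h1 := U.σ_real_pos
  have h2 := denom_pos hs j
  have h3 : (U.total j : ℝ) = U.total 0 + U.σ * j := by simp [total]
  have h4 : (U.total 0 : ℝ) / U.σ + U.index + j = (U.total j + U.m * U.slope) / U.σ := by
    rw [index_eq, h3]; field_simp; ring
  have h5 : (U.total 0 : ℝ) / U.σ + j = U.total j / U.σ := by rw [h3]; field_simp
  rw [h4, h5, slope]
  field_simp

lemma tendsto_g : Tendsto U.g atTop (𝓝 0) := by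
  have h1 : Tendsto (fun n : ℕ => (n : ℝ) ^ (-U.index)) atTop (𝓝 0) :=
    (tendsto_rpow_neg_atTop (index_pos hs)).comp tendsto_natCast_atTop_atTop
  have h2 := (tendsto_g_mul_rpow hs).mul h1
  rw [mul_zero] at h2
  refine h2.congr' ?_
  filter_upwards [eventually_gt_atTop 0] with n hn
  have hn' : (0 : ℝ) < n := by exact_mod_cast hn
  rw [mul_assoc, ← Real.rpow_add hn', add_neg_cancel, Real.rpow_zero, mul_one]

lemma summable_g_sq (hi : 1 / 2 < U.index) : Summable fun n => U.g n ^ 2 := by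
  have h1 : Summable fun n : ℕ => (n : ℝ) ^ (-(2 * U.index)) :=
    Real.summable_nat_rpow.2 (by linarith)
  refine summable_of_isBigO_nat h1 ?_
  have h2 : (fun n : ℕ => U.g n * (n : ℝ) ^ U.index) =O[atTop] fun _ => (1 : ℝ) :=
    (tendsto_g_mul_rpow hs).isBigO_one ℝ
  have h3 := (h2.pow 2).mul
    (Asymptotics.isBigO_refl (fun n : ℕ => (n : ℝ) ^ (-(2 * U.index))) atTop)
  refine Asymptotics.IsBigO.congr' h3 ?_ (Eventually.of_forall fun n => by simp)
  filter_upwards [eventually_gt_atTop 0] with n hn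
  have hn' : (0 : ℝ) < n := by exact_mod_cast hn
  rw [mul_pow, mul_assoc, ← Real.rpow_mul_natCast hn'.le, ← Real.rpow_add hn']
  rw [show U.index * (2 : ℕ) + -(2 * U.index) = 0 by push_cast; ring, Real.rpow_zero, mul_one]

end AffineUrn

/-! ### The two families of urns. -/

namespace AffineUrn

variable {Ω : Type*} {U : AffineUrn} {M : SamplingModel} {X : ℕ → Ω → Fin (U.m + 1)}
variable [mΩ : MeasurableSpace Ω] {μ : Measure Ω} [IsProbabilityMeasure μ]

namespace IsDrawSequence

variable (hX : U.IsDrawSequence M μ X) (hs : 0 < U.slope)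
include hX hs

/-- As `c σ n` is exactly the shift in `W̃_n`, `g_n W̃_n = M_n + g_n c T_0`, and the last term
vanishes in the limit. Dividing by `(g_n n ^ Λ) ^ s` cancels `g_n ^ s`. -/
lemma isShiftedMomentLimit {c : ℝ} (hcσ : c * U.σ = U.a U.m / (1 - U.index)) {Y : Ω → ℝ}
    (hY : ∀ s : ℕ, Integrable (fun ω => Y ω ^ s) μ)
    (hlim : ∀ s : ℕ, Tendsto (fun n => ∫ ω, U.martValue c n (U.white X n ω) ^ s ∂μ) atTop
        (𝓝 (∫ ω, Y ω ^ s ∂μ))) :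
    U.IsShiftedMomentLimit μ X fun s => (∫ ω, Y ω ^ s ∂μ) / U.gammaRatio ^ s := by
  intro s
  have he : Tendsto (fun n => U.g n * (c * U.total 0)) atTop (𝓝 0) := by
    simpa using (tendsto_g hs).mul_const (c * U.total 0)
  have h1 := tendsto_integral_add_pow
    (fun n s => hX.integrable_comp_white n fun w => U.martValue c n w ^ s) hY hlim he s
  refine (h1.div ((tendsto_g_mul_rpow hs).pow s)
    (pow_ne_zero s (gammaRatio_pos hs).ne')).congr' ?_
  filter_upwards [eventually_gt_atTop 0] with n hn
  have hn' : (0 : ℝ) < n := by exact_mod_cast hn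
  have hg := g_pos hs n
  have e : ∀ ω, U.martValue c n (U.white X n ω) + U.g n * (c * U.total 0) =
      U.g n * U.shifted X n ω := by
    intro ω
    have h3 : (U.total n : ℝ) = U.total 0 + U.σ * n := by simp [total]
    rw [shifted, ← hcσ, martValue, h3]
    ring
  simp only [Pi.div_apply, e, mul_pow]
  rw [integral_const_mul, integral_div, mul_comm (s : ℝ), Real.rpow_mul_natCast hn'.le,
    mul_div_mul_left _ _ (pow_ne_zero s hg.ne')]

/-- The mean of the martingale stays at its initial value `W_0 - c T_0`. -/
lemma centered_eq (hU : U.Tenable M) {c : ℝ} (hc : c * (U.σ - U.m * U.slope) = U.a U.m)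
    (n : ℕ) (ω : Ω) :
    U.centered μ X n ω = U.martValue c n (U.white X n ω) + (c * U.total 0 - U.W₀) := by
  have hmart := hX.martingale_martValue hU hs hc
  have h1 : ∫ ω', U.martValue c n (U.white X n ω') ∂μ = U.W₀ - c * U.total 0 := by
    rw [← integral_condExp ((drawFiltration hX.measurable).le 0),
      integral_congr_ae (hmart.2 0 n (Nat.zero_le n))]
    simp [martValue, white_zero, g_zero]
  have h2 : ∫ ω', U.martValue c n (U.white X n ω') ∂μ =
      U.g n * (∫ ω', (U.white X n ω' : ℝ) ∂μ - c * U.total n) := by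
    simp only [martValue]
    rw [integral_const_mul, integral_sub
      (hX.integrable_comp_white n fun w => (w : ℝ)) (integrable_const _)]
    simp
  rw [centered, martValue]
  linear_combination h2 - h1

theorem large_index (hU : U.Tenable M) (hi : 1 / 2 < U.index) (hi' : U.index < 1) :
    (∀ᵐ ω ∂μ, Tendsto (fun n => U.centered μ X n ω) atTop (𝓝 (U.centeredLimit μ X ω))) ∧
      ∃ E : ℕ → ℝ, U.IsShiftedMomentLimit μ X E ∧
        ∀ s : ℕ, 1 ≤ s →
          Integrable (fun ω => U.centeredLimit μ X ω ^ s) μ ∧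
          ∫ ω, U.centeredLimit μ X ω ^ s ∂μ =
            ∑ k ∈ Finset.range (s + 1), (s.choose k : ℝ) * U.gammaRatio ^ k * E k *
              ((U.a U.m : ℝ) * (U.total 0 : ℝ) / ((U.σ : ℝ) * (1 - U.index)) - (U.W₀ : ℝ))
                ^ (s - k) := by
  have hσ := U.σ_real_pos
  have hm := U.m_real_pos
  have h1 : 0 < 1 - U.index := by linarith
  set c : ℝ := U.a U.m / (U.σ * (1 - U.index)) with hcdef
  have hcσ : c * U.σ = U.a U.m / (1 - U.index) := by rw [hcdef]; field_simp
  have hc : c * (U.σ - U.m * U.slope) = U.a U.m := by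
    have h2 : (U.σ : ℝ) - U.m * U.slope = U.σ * (1 - U.index) := by
      rw [index_eq]; field_simp
    rw [h2, hcdef, div_mul_cancel₀ _ (mul_pos hσ h1).ne']
  -- Here `W_n / T_n ≤ 1` suffices, and `Λ > 1/2` makes these `ε_n` summable.
  have hsum : Summable fun n => (U.slope * U.m) ^ 2 * U.g (n + 1) ^ 2 :=
    ((summable_nat_add_iff 1).2 (summable_g_sq hs hi)).mul_left _
  obtain ⟨Y, hY, hYs, hYlim⟩ := hX.exists_limit hU hs hc
    (hX.exists_moment_bound hU hs hc (fun n => by positivity)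
      (fun n => hsum.sum_le_tsum _ fun i _ => by positivity) fun n w h0 h0' => by
        refine (sum_nextProb_mul_martStep_sq_le h0 h0').trans ?_
        calc (U.g (n + 1) * U.slope) ^ 2 * (U.m * (U.m * w / U.total n))
            ≤ (U.g (n + 1) * U.slope) ^ 2 * (U.m * U.m) := by
              gcongr
              exact (mean_mem_Icc h0 h0').2
          _ = (U.slope * U.m) ^ 2 * U.g (n + 1) ^ 2 * 1 := by ring
          _ ≤ _ := by
              gcongr
              linarith [abs_nonneg (U.martValue c n w)])
  have hlim : ∀ᵐ ω ∂μ, Tendsto (fun n => U.centered μ X n ω) atTop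
      (𝓝 (Y ω + (c * U.total 0 - U.W₀))) := by
    filter_upwards [hY] with ω hω
    simp only [hX.centered_eq hs hU hc]
    exact hω.add_const _
  have hae : ∀ᵐ ω ∂μ, U.centeredLimit μ X ω = Y ω + (c * U.total 0 - U.W₀) := by
    filter_upwards [hlim] with ω hω using hω.limUnder_eq
  refine ⟨?_, _, hX.isShiftedMomentLimit hs hcσ hYs hYlim, fun s _ => ⟨?_, ?_⟩⟩
  · filter_upwards [hlim, hae] with ω h2 h3
    rwa [h3]
  · refine (integrable_add_const_pow hYs (c * U.total 0 - U.W₀) s).congr ?_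
    filter_upwards [hae] with ω hω
    rw [hω]
  · rw [integral_congr_ae (g := fun ω => (Y ω + (c * U.total 0 - U.W₀)) ^ s)
      (by filter_upwards [hae] with ω hω; rw [hω]), integral_add_const_pow hYs]
    refine Finset.sum_congr rfl fun k _ => ?_
    have h2 := pow_ne_zero k (gammaRatio_pos hs).ne'
    rw [mul_assoc _ (U.gammaRatio ^ k), mul_div_cancel₀ _ h2, hcdef, div_mul_eq_mul_div]
    ring

theorem triangular (hU : U.Tenable M) (ha : U.a U.m = 0) :
    (∀ᵐ ω ∂μ, Tendsto (fun n => U.scaled X n ω) atTop (𝓝 (U.scaledLimit X ω))) ∧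
      ∃ E : ℕ → ℝ, U.IsShiftedMomentLimit μ X E ∧
        ∀ s : ℕ, 1 ≤ s →
          Integrable (fun ω => U.scaledLimit X ω ^ s) μ ∧
          ∫ ω, U.scaledLimit X ω ^ s ∂μ = U.gammaRatio ^ s * E s := by
  have hm := U.m_real_pos
  -- With `a_m = 0` the quotient is `0` even at `Λ = 1`, where the denominator vanishes.
  have hcσ : (0 : ℝ) * U.σ = U.a U.m / (1 - U.index) := by simp [ha]
  have hc : (0 : ℝ) * (U.σ - U.m * U.slope) = U.a U.m := by simp [ha]
  obtain ⟨Y, hY, hYs, hYlim⟩ := hX.exists_limit hU hs hc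
    (hX.exists_moment_bound hU hs hc (ε := fun n => U.slope * U.m * (U.g n - U.g (n + 1)))
      (S := U.slope * U.m)
      (fun n => mul_nonneg (by positivity) (sub_nonneg.2 (g_succ_le hs n)))
      (fun n => by
        rw [← Finset.mul_sum, Finset.sum_range_sub', g_zero]
        have := g_pos hs n
        nlinarith [mul_pos hs hm]) fun n w h0 h0' => by
        refine (sum_nextProb_mul_martStep_sq_le h0 h0').trans ?_
        have hT := U.total_real_pos n
        have hg := g_pos hs (n + 1)
        have hw : (0 : ℝ) ≤ w := by exact_mod_cast h0
        -- This turns the factor `g_{n+1} / T_n` of the variance bound into a telescoping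
        -- difference; the remaining `g_{n+1} W_n` is at most the martingale itself.
        have e : U.g n - U.g (n + 1) = U.g (n + 1) * (U.m * U.slope) / U.total n := by
          rw [g_eq_succ hs n]; ring
        calc (U.g (n + 1) * U.slope) ^ 2 * (U.m * (U.m * w / U.total n))
            = U.slope * U.m * (U.g n - U.g (n + 1)) * (U.g (n + 1) * w) := by rw [e]; ring
          _ ≤ U.slope * U.m * (U.g n - U.g (n + 1)) * (1 + |U.martValue 0 n w|) := by
              refine mul_le_mul_of_nonneg_left ?_
                (mul_nonneg (by positivity) (sub_nonneg.2 (g_succ_le hs n)))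
              have h1 : U.g (n + 1) * w ≤ U.martValue 0 n w := by
                rw [martValue, zero_mul, sub_zero]
                exact mul_le_mul_of_nonneg_right (g_succ_le hs n) hw
              linarith [le_abs_self (U.martValue 0 n w)])
  have hlim : ∀ᵐ ω ∂μ, Tendsto (fun n => U.scaled X n ω) atTop (𝓝 (Y ω)) := by
    filter_upwards [hY] with ω hω
    simpa only [scaled, martValue, zero_mul, sub_zero] using hω
  have hae : ∀ᵐ ω ∂μ, U.scaledLimit X ω = Y ω := by
    filter_upwards [hlim] with ω hω using hω.limUnder_eq
  have hpow : ∀ s : ℕ, (fun ω => U.scaledLimit X ω ^ s) =ᵐ[μ] fun ω => Y ω ^ s := fun s => by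
    filter_upwards [hae] with ω hω
    rw [hω]
  refine ⟨?_, _, hX.isShiftedMomentLimit hs hcσ hYs hYlim, fun s _ =>
    ⟨(hYs s).congr (hpow s).symm, ?_⟩⟩
  · filter_upwards [hlim, hae] with ω h2 h3
    rwa [h3]
  · rw [integral_congr_ae (hpow s), mul_div_cancel₀ _ (pow_ne_zero s (gammaRatio_pos hs).ne')]

end IsDrawSequence

end AffineUrn

theorem mainTheorem2 {Ω : Type*} [MeasurableSpace Ω] (μ : Measure Ω) [IsProbabilityMeasure μ]
    (U : AffineUrn) (M : SamplingModel) (hU : U.Tenable M)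
    (X : ℕ → Ω → Fin (U.m + 1)) (hX : U.IsDrawSequence M μ X) :
    -- large-index urns
    ((1 / 2 < U.index ∧ U.index < 1) →
      (∀ᵐ ω ∂μ, Tendsto (fun n => U.centered μ X n ω) atTop (𝓝 (U.centeredLimit μ X ω))) ∧
      ∃ E : ℕ → ℝ, U.IsShiftedMomentLimit μ X E ∧
        ∀ s : ℕ, 1 ≤ s →
          Integrable (fun ω => U.centeredLimit μ X ω ^ s) μ ∧
          ∫ ω, U.centeredLimit μ X ω ^ s ∂μ =
            ∑ k ∈ Finset.range (s + 1), (s.choose k : ℝ) * U.gammaRatio ^ k * E k *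
              ((U.a U.m : ℝ) * (U.total 0 : ℝ) / ((U.σ : ℝ) * (1 - U.index)) - (U.W₀ : ℝ))
                ^ (s - k)) ∧
    -- triangular urns
    ((U.a U.m = 0 ∧ 0 < U.a (U.m - 1)) →
      (∀ᵐ ω ∂μ, Tendsto (fun n => U.scaled X n ω) atTop (𝓝 (U.scaledLimit X ω))) ∧
      ∃ E : ℕ → ℝ, U.IsShiftedMomentLimit μ X E ∧
        ∀ s : ℕ, 1 ≤ s →
          Integrable (fun ω => U.scaledLimit X ω ^ s) μ ∧
          ∫ ω, U.scaledLimit X ω ^ s ∂μ = U.gammaRatio ^ s * E s) := by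
  refine ⟨fun ⟨hi, hi'⟩ => ?_, fun ⟨ha, ha'⟩ => ?_⟩
  · have hs : 0 < U.slope := by
      by_contra! h
      have h1 : U.index ≤ 0 := by
        rw [AffineUrn.index_eq]
        exact div_nonpos_of_nonpos_of_nonneg
          (mul_nonpos_of_nonneg_of_nonpos U.m_real_pos.le h) U.σ_real_pos.le
      linarith
    exact hX.large_index hs hU hi hi'
  · have hs : 0 < U.slope := by
      rw [AffineUrn.slope, ha, Int.cast_zero, sub_zero]
      exact_mod_cast ha'
    exact hX.triangular hs hU ha
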